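/- Let $V$ be a finite-dimensional real Euclidean space and let $\Phi\subset V$ be a crystallographic root system, i.e. a finite set of nonzero vectors such that $s_\alpha(\beta)\in\Phi$ and $\langle\alpha,\beta^\vee\rangle\in\mathbb Z$ for all $\alpha,\beta\in\Phi$, and such that $\alpha,c\alpha\in\Phi$ with $c\in\mathbb R$ implies $c=\pm1$. Here $\beta^\vee=2\beta/\langle\beta,\beta\rangle$ and $s_\alpha(v)=v-\langle v,\alpha^\vee\rangle\alpha$. ($\Phi$ may be reducible, may be empty, and need not span $V$.) Let $W$ be the group generated by the reflections $s_\alpha$, $\alpha\in\Phi$. A simple system of a root system $\Psi$ is a linearly independent subset $\Gamma\subseteq\Psi$ such that $\Psi$ is the disjoint union of $\Psi_+:=\Psi\cap\mathbb R_{\ge0}\Gamma$ and $-\Psi_+$. A simple subsystem of $\Phi$ is a simple system of a root subsystem $\Phi_{W'}=\{\alpha\in\Phi\mid s_\alpha\in W'\}$, where $W'$ is a subgroup of $W$ generated by some of the reflections $s_\alpha$, $\alpha\in\Phi$. Let $L>0$ be a real number, and consider the simple subsystems $\Delta$ of $\Phi$ satisfying the following three conditions: (i) $\Delta$ is of type $A_1^n$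 for some $n\ge 0$, i.e. the Cartan matrix $(\langle\beta_i^\vee,\beta_j\rangle)_{i,j}$ of $\Delta=\{\beta_1,\dots,\beta_n\}$ is the Cartan matrix of type $A_1^n$; (ii) all roots in $\Delta$ have length $L$; (iii) $\Delta$ is maximal with respect to inclusion among the simple subsystems of $\Phi$ satisfying (i) and (ii). Then any two simple subsystems $\Delta,\Delta'$ of $\Phi$ satisfying (i)–(iii) are conjugate under $W$, i.e. there is $w\in W$ with $w(\Delta)=\Delta'$. -/

import Mathlib

open scoped NNReal Pointwise RealInnerProductSpace

namespace EuclideanRoots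

variable {V : Type*} [NormedAddCommGroup V] [InnerProductSpace ℝ V]

/-- The number `⟨v, α^∨⟩`, where `α^∨ = (2 / ⟨α, α⟩) α`. -/
noncomputable def pairing (v α : V) : ℝ := 2 * ⟪v, α⟫ / ⟪α, α⟫

/-- The orthogonal reflection `s_α` in the hyperplane orthogonal to `α`. -/
noncomputable def rootReflection (α : V) : V ≃ₗᵢ[ℝ] V := (Submodule.span ℝ {α})ᗮ.reflection

/-- Finite, reduced root systems; they need neither span `V` nor be crystallographic. -/
structure IsRootSystem (Φ : Set V) : Prop where
  finite : Φ.Finite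
  zero_notMem : (0 : V) ∉ Φ
  reflection_mem : ∀ α ∈ Φ, ∀ β ∈ Φ, rootReflection α β ∈ Φ
  reduced : ∀ α ∈ Φ, ∀ c : ℝ, c • α ∈ Φ → c = 1 ∨ c = -1

/-- `Φ` is crystallographic if `⟨α, β^∨⟩` is an integer for all `α, β ∈ Φ`. -/
def IsCrystallographic (Φ : Set V) : Prop :=
  ∀ α ∈ Φ, ∀ β ∈ Φ, ∃ k : ℤ, pairing α β = k

/-- The group `W` generated by the reflections in the elements of `Φ`. -/
noncomputable def weylGroup (Φ : Set V) : Subgroup (V ≃ₗᵢ[ℝ] V) :=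
  Subgroup.closure (rootReflection '' Φ)

/-- The elements of `Φ` that are nonnegative real linear combinations of elements of `Γ`. -/
def positivePart (Φ Γ : Set V) : Set V := Φ ∩ (Submodule.span ℝ≥0 Γ : Set V)

/-- `Γ` is a simple system of `Φ`: a linearly independent subset such that `Φ` is the disjoint
union of `Φ₊ = Φ ∩ ℝ≥0 Γ` and `-Φ₊`. -/
structure IsSimpleSystem (Φ Γ : Set V) : Prop where
  subset : Γ ⊆ Φ
  linearIndep : LinearIndepOn ℝ id Γ
  union_eq : positivePart Φ Γ ∪ -positivePart Φ Γ = Φ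
  disjoint : Disjoint (positivePart Φ Γ) (-positivePart Φ Γ)

/-- A reflection subgroup: a subgroup generated by some of the reflections in roots of `Φ`. -/
def IsReflectionSubgroup (Φ : Set V) (W' : Subgroup (V ≃ₗᵢ[ℝ] V)) : Prop :=
  ∃ A ⊆ rootReflection '' Φ, W' = Subgroup.closure A

/-- The root subsystem `{α ∈ Φ | s_α ∈ W'}` of `Φ` attached to `W'`. -/
def rootSubsystem (Φ : Set V) (W' : Subgroup (V ≃ₗᵢ[ℝ] V)) : Set V :=
  {α ∈ Φ | rootReflection α ∈ W'}

/-- A simple subsystem of `Φ`: a simple system of some root subsystem of `Φ`. -/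
def IsSimpleSubsystem (Φ Δ : Set V) : Prop :=
  ∃ W' : Subgroup (V ≃ₗᵢ[ℝ] V),
    IsReflectionSubgroup Φ W' ∧ IsSimpleSystem (rootSubsystem Φ W') Δ

/-- `Δ` has Cartan type `A`: for some indexing of the elements of `Δ` its matrix of the numbers
`⟨β_i^∨, β_j⟩` is `A`. -/
def HasCartanType {ι : Type*} (Δ : Set V) (A : Matrix ι ι ℤ) : Prop :=
  ∃ b : ι ≃ Δ, ∀ i j, pairing (b j : V) (b i : V) = A i j

/-- `Δ` is of type `A₁ⁿ`: its Cartan matrix is the block diagonal matrix with `n` blocks, each the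
Cartan matrix of type `A₁`. -/
def IsOfTypeA1Pow (Δ : Set V) (n : ℕ) : Prop :=
  HasCartanType Δ (Matrix.blockDiagonal fun _ : Fin n => CartanMatrix.A 1)

/-- Simple subsystems of `Φ` that are of type `A₁ⁿ` for some `n` and all of whose roots have
length `L`. -/
def IsA1SubsystemOfLength (Φ : Set V) (L : ℝ) (Δ : Set V) : Prop :=
  IsSimpleSubsystem Φ Δ ∧ (∃ n : ℕ, IsOfTypeA1Pow Δ n) ∧ ∀ α ∈ Δ, ‖α‖ = L

end EuclideanRoots

namespace EuclideanRoots

section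

variable {V : Type*} [NormedAddCommGroup V] [InnerProductSpace ℝ V]

/-! Conditions (i) and (ii) only say that `Δ` is a set of pairwise orthogonal roots of length `L`
(`isA1SubsystemOfLength_iff`), so one may work inside the set `Ψ` of roots of length `L`, which is
closed under its own reflections. Integrality makes nonorthogonal roots of `Ψ` conjugate. Given
maximal orthogonal sets `Δ`, `Δ'` and `α ∈ Δ'`, maximality yields `β ∈ Δ` not orthogonal to `α`;
moving `β` to `α` lets both sets contain `α`. Deleting `α` leaves maximal orthogonal sets in `Ψ ∩
α^⊥`, whose Weyl group fixes `α`, so induction on `|Ψ|` finishes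
(`IsEqualLengthSystem.exists_image_eq`). -/

theorem rootReflection_apply (α v : V) : rootReflection α v = v - pairing v α • α := by
  rw [rootReflection, Submodule.reflection_orthogonal_apply, Submodule.reflection_singleton_apply,
    pairing, real_inner_self_eq_norm_sq, real_inner_comm, mul_div_assoc, mul_smul, two_smul, two_smul]
  simp

theorem rootReflection_self (α : V) : rootReflection α α = -α :=
  Submodule.reflection_orthogonalComplement_singleton_eq_neg α

theorem rootReflection_of_inner_eq_zero {α v : V} (h : ⟪v, α⟫ = 0) : rootReflection α v = v := by
  simp [rootReflection_apply, pairing, h]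

/-- `Δ` is a set of pairwise orthogonal elements of `Ψ`. -/
def IsOrthogonalSubset (Ψ Δ : Set V) : Prop :=
  Δ ⊆ Ψ ∧ ∀ α ∈ Δ, ∀ β ∈ Δ, α ≠ β → ⟪α, β⟫ = 0

/-- The pairings of the root system `Ψ` are integral and its roots have the common length `L`;
it is finite and closed under its reflections. -/
structure IsEqualLengthSystem (L : ℝ) (Ψ : Set V) : Prop where
  finite : Ψ.Finite
  norm_eq : ∀ α ∈ Ψ, ‖α‖ = L
  reflection_mem : ∀ α ∈ Ψ, ∀ β ∈ Ψ, rootReflection α β ∈ Ψ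
  crystallographic : IsCrystallographic Ψ

theorem weylGroup_mono {Ψ Φ : Set V} (h : Ψ ⊆ Φ) : weylGroup Ψ ≤ weylGroup Φ :=
  Subgroup.closure_mono (Set.image_mono h)

theorem rootReflection_mem_weylGroup {Ψ : Set V} {α : V} (hα : α ∈ Ψ) :
    rootReflection α ∈ weylGroup Ψ :=
  Subgroup.subset_closure ⟨α, hα, rfl⟩

theorem rootReflection_inv (α : V) : (rootReflection α)⁻¹ = rootReflection α :=
  Submodule.reflection_symm

theorem weylGroup_apply_mem {Ψ : Set V} (h : ∀ α ∈ Ψ, ∀ β ∈ Ψ, rootReflection α β ∈ Ψ)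
    {w : V ≃ₗᵢ[ℝ] V} (hw : w ∈ weylGroup Ψ) : ∀ β ∈ Ψ, w β ∈ Ψ := by
  induction hw using Subgroup.closure_induction'' with
  | mem x hx => obtain ⟨α, hα, rfl⟩ := hx; exact h α hα
  | inv_mem x hx => obtain ⟨α, hα, rfl⟩ := hx; rw [rootReflection_inv]; exact h α hα
  | one => exact fun β hβ => hβ
  | mul x y _ _ hx hy => exact fun β hβ => hx _ (hy _ hβ)

theorem weylGroup_apply_eq_self {Ψ : Set V} {v : V} (h : ∀ α ∈ Ψ, ⟪v, α⟫ = 0)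
    {w : V ≃ₗᵢ[ℝ] V} (hw : w ∈ weylGroup Ψ) : w v = v := by
  induction hw using Subgroup.closure_induction'' with
  | mem x hx => obtain ⟨α, hα, rfl⟩ := hx; exact rootReflection_of_inner_eq_zero (h α hα)
  | inv_mem x hx =>
    obtain ⟨α, hα, rfl⟩ := hx
    rw [rootReflection_inv]; exact rootReflection_of_inner_eq_zero (h α hα)
  | one => rfl
  | mul x y _ _ hx hy => change x (y v) = v; rw [hy, hx]

/-- Roots of equal length at an acute angle are conjugate. -/
theorem IsEqualLengthSystem.exists_apply_eq_of_inner_pos {L : ℝ} {Ψ : Set V}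
    (hΨ : IsEqualLengthSystem L Ψ) (hL : 0 < L) {α β : V} (hα : α ∈ Ψ) (hβ : β ∈ Ψ)
    (h : 0 < ⟪β, α⟫) : ∃ w ∈ weylGroup Ψ, w β = α := by
  by_cases hne : β = α
  · exact ⟨1, one_mem _, hne⟩
  obtain ⟨k, hk⟩ := hΨ.crystallographic β hβ α hα
  have hnα := hΨ.norm_eq α hα
  have hnβ := hΨ.norm_eq β hβ
  -- Strict because `β ≠ α`; with equal lengths this bounds the integer `⟨β, α^∨⟩` strictly between
  -- 0 and 2.
  have hlt : ⟪β, α⟫ < L ^ 2 := by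
    have h0 : 0 < ‖β - α‖ ^ 2 := by
      have := norm_pos_iff.2 (sub_ne_zero.2 hne)
      positivity
    rw [norm_sub_sq_real, hnα, hnβ] at h0
    linarith
  have hL2 : 0 < L ^ 2 := by positivity
  have hk' := hk
  rw [pairing, real_inner_self_eq_norm_sq, hnα, div_eq_iff hL2.ne'] at hk'
  have hk0 : 0 < k := by
    have : (0 : ℝ) < k := by
      by_contra! hc
      nlinarith
    exact_mod_cast this
  have hk2 : k < 2 := by
    have : (k : ℝ) < 2 := by
      by_contra! hc
      nlinarith
    exact_mod_cast this
  have hk1 : k = 1 := by omega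
  -- Now `s_α β = β - α` is a root, and its reflection swaps `β` and `α` since they have equal
  -- length.
  have hmem := hΨ.reflection_mem α hα β hβ
  rw [rootReflection_apply, hk, hk1, Int.cast_one, one_smul] at hmem
  exact ⟨_, rootReflection_mem_weylGroup hmem, Submodule.reflection_sub (hnβ.trans hnα.symm)⟩

/-- Nonorthogonal roots of equal length are conjugate. -/
theorem IsEqualLengthSystem.exists_apply_eq {L : ℝ} {Ψ : Set V}
    (hΨ : IsEqualLengthSystem L Ψ) (hL : 0 < L) {α β : V} (hα : α ∈ Ψ) (hβ : β ∈ Ψ)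
    (h : ⟪β, α⟫ ≠ 0) : ∃ w ∈ weylGroup Ψ, w β = α := by
  rcases lt_or_gt_of_ne h with h | h
  · have hneg : rootReflection β β ∈ Ψ := hΨ.reflection_mem β hβ β hβ
    have hpos : 0 < ⟪rootReflection β β, α⟫ := by
      rw [rootReflection_self, inner_neg_left]; linarith
    obtain ⟨w, hw, hwα⟩ := hΨ.exists_apply_eq_of_inner_pos hL hα hneg hpos
    exact ⟨w * rootReflection β, mul_mem hw (rootReflection_mem_weylGroup hβ), hwα⟩
  · exact hΨ.exists_apply_eq_of_inner_pos hL hα hβ h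

/-! ### Maximal orthogonal sets of roots and their conjugacy -/

theorem IsOrthogonalSubset.image {Ψ Δ : Set V} (hΔ : IsOrthogonalSubset Ψ Δ)
    {w : V ≃ₗᵢ[ℝ] V} (hw : ∀ β ∈ Ψ, w β ∈ Ψ) : IsOrthogonalSubset Ψ (w '' Δ) := by
  refine ⟨?_, ?_⟩
  · rintro _ ⟨β, hβ, rfl⟩
    exact hw β (hΔ.1 hβ)
  · rintro _ ⟨α, hα, rfl⟩ _ ⟨β, hβ, rfl⟩ hne
    rw [LinearIsometryEquiv.inner_map_map]
    exact hΔ.2 α hα β hβ fun h => hne (h ▸ rfl)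

theorem IsOrthogonalSubset.insert {Ψ Δ : Set V} {α : V} (hΔ : IsOrthogonalSubset Ψ Δ) (hα : α ∈ Ψ)
    (h : ∀ β ∈ Δ, ⟪α, β⟫ = 0) : IsOrthogonalSubset Ψ (insert α Δ) := by
  refine ⟨Set.insert_subset hα hΔ.1, ?_⟩
  rintro β (rfl | hβ) γ (rfl | hγ) hne
  · exact absurd rfl hne
  · exact h γ hγ
  · rw [real_inner_comm]; exact h β hβ
  · exact hΔ.2 β hβ γ hγ hne

theorem maximal_isOrthogonalSubset_image {Ψ Δ : Set V}
    (hΨ : ∀ α ∈ Ψ, ∀ β ∈ Ψ, rootReflection α β ∈ Ψ) (hΔ : Maximal (IsOrthogonalSubset Ψ) Δ)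
    {w : V ≃ₗᵢ[ℝ] V} (hw : w ∈ weylGroup Ψ) : Maximal (IsOrthogonalSubset Ψ) (w '' Δ) := by
  refine ⟨hΔ.1.image (weylGroup_apply_mem hΨ hw), fun Γ hΓ hle => ?_⟩
  have hΓ' := hΓ.image (weylGroup_apply_mem hΨ (inv_mem hw))
  have hsub : Δ ⊆ (w⁻¹ : V ≃ₗᵢ[ℝ] V) '' Γ := fun β hβ =>
    ⟨w β, hle ⟨β, hβ, rfl⟩, w.symm_apply_apply β⟩
  intro γ hγ
  exact ⟨w⁻¹ γ, hΔ.2 hΓ' hsub ⟨γ, hγ, rfl⟩, w.apply_symm_apply γ⟩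

/-- The elements of `Ψ` orthogonal to `α`. -/
def orthogonalPart (Ψ : Set V) (α : V) : Set V := {γ ∈ Ψ | ⟪α, γ⟫ = 0}

theorem IsEqualLengthSystem.orthogonalPart {L : ℝ} {Ψ : Set V} (hΨ : IsEqualLengthSystem L Ψ)
    (α : V) : IsEqualLengthSystem L (orthogonalPart Ψ α) where
  finite := hΨ.finite.subset fun _ h => h.1
  norm_eq γ hγ := hΨ.norm_eq γ hγ.1
  reflection_mem γ hγ δ hδ := by
    refine ⟨hΨ.reflection_mem γ hγ.1 δ hδ.1, ?_⟩
    rw [rootReflection_apply, inner_sub_right, inner_smul_right, hγ.2, hδ.2]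
    simp
  crystallographic γ hγ δ hδ := hΨ.crystallographic γ hγ.1 δ hδ.1

/-- Adjoining `α` to a competitor inside `α^⊥` gives an orthogonal set in `Ψ` containing `Δ`, to
which maximality of `Δ` applies. -/
theorem maximal_isOrthogonalSubset_diff_singleton {Ψ Δ : Set V} {α : V}
    (hα : α ∈ Δ) (hα0 : α ≠ 0) (hΔ : Maximal (IsOrthogonalSubset Ψ) Δ) :
    Maximal (IsOrthogonalSubset (orthogonalPart Ψ α)) (Δ \ {α}) := by
  refine ⟨⟨fun γ hγ => ⟨hΔ.1.1 hγ.1, hΔ.1.2 α hα γ hγ.1 (Ne.symm hγ.2)⟩,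
    fun β hβ γ hγ => hΔ.1.2 β hβ.1 γ hγ.1⟩, fun Γ hΓ hle γ hγ => ?_⟩
  have hins : IsOrthogonalSubset Ψ (insert α Γ) :=
    IsOrthogonalSubset.insert ⟨fun x hx => (hΓ.1 hx).1, hΓ.2⟩ (hΔ.1.1 hα) fun β hβ => (hΓ.1 hβ).2
  have hsub : Δ ⊆ insert α Γ := fun δ hδ => by
    by_cases h : δ = α
    · exact Or.inl h
    · exact Or.inr (hle ⟨hδ, h⟩)
  refine ⟨hΔ.2 hins hsub (Or.inr hγ), ?_⟩
  rintro rfl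
  exact hα0 (inner_self_eq_zero.1 (hΓ.1 hγ).2)

/-- In a crystallographic root system with a single root length, any two maximal sets of pairwise
orthogonal roots are conjugate under the Weyl group. -/
theorem IsEqualLengthSystem.exists_image_eq {L : ℝ} (hL : 0 < L) {Ψ : Set V}
    (hΨ : IsEqualLengthSystem L Ψ) {Δ Δ' : Set V} (hΔ : Maximal (IsOrthogonalSubset Ψ) Δ)
    (hΔ' : Maximal (IsOrthogonalSubset Ψ) Δ') : ∃ w ∈ weylGroup Ψ, w '' Δ = Δ' := by
  induction hn : Ψ.ncard using Nat.strong_induction_on generalizing Ψ Δ Δ' with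
  | _ n ih =>
  subst hn
  have ne_zero : ∀ α ∈ Ψ, α ≠ 0 := fun α hα => norm_ne_zero_iff.1 ((hΨ.norm_eq α hα).trans_ne hL.ne')
  rcases Δ'.eq_empty_or_nonempty with rfl | ⟨α, hα⟩
  · refine ⟨1, one_mem _, Set.image_eq_empty.2 ?_⟩
    exact Set.subset_empty_iff.1 (hΔ'.2 hΔ.1 (Set.empty_subset _))
  have hαΨ := hΔ'.1.1 hα
  obtain ⟨β, hβ, hβα⟩ : ∃ β ∈ Δ, ⟪β, α⟫ ≠ 0 := by
    by_contra! hc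
    have hmem : α ∈ Δ := hΔ.2
      (hΔ.1.insert hαΨ fun β hβ => by rw [real_inner_comm]; exact hc β hβ)
      (Set.subset_insert _ _) (Set.mem_insert _ _)
    exact ne_zero α hαΨ (inner_self_eq_zero.1 (hc α hmem))
  obtain ⟨g, hg, hgβ⟩ := hΨ.exists_apply_eq hL hαΨ (hΔ.1.1 hβ) hβα
  have hαg : α ∈ g '' Δ := ⟨β, hβ, hgβ⟩
  have hgΔ := maximal_isOrthogonalSubset_image hΨ.reflection_mem hΔ hg
  have hcard : (EuclideanRoots.orthogonalPart Ψ α).ncard < Ψ.ncard := by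
    refine Set.ncard_lt_ncard ⟨fun _ h => h.1, fun h => ?_⟩ hΨ.finite
    exact ne_zero α hαΨ (inner_self_eq_zero.1 (h hαΨ).2)
  obtain ⟨w, hw, hwΔ⟩ := ih _ hcard (hΨ.orthogonalPart α)
    (maximal_isOrthogonalSubset_diff_singleton hαg (ne_zero α hαΨ) hgΔ)
    (maximal_isOrthogonalSubset_diff_singleton hα (ne_zero α hαΨ) hΔ') rfl
  have hwα : w α = α := weylGroup_apply_eq_self (fun γ hγ => hγ.2) hw
  refine ⟨w * g, mul_mem (weylGroup_mono (fun _ h => h.1) hw) hg, ?_⟩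
  have hcomp : (w * g) '' Δ = w '' (g '' Δ) := Set.image_comp w g Δ
  rw [hcomp, ← Set.insert_eq_of_mem hαg, ← Set.insert_sdiff_singleton, Set.image_insert_eq, hwα, hwΔ,
    Set.insert_sdiff_singleton, Set.insert_eq_of_mem hα]

/-! ### Orthogonal sets of roots as simple subsystems of type `A₁ⁿ` -/

theorem IsOrthogonalSubset.weylGroup_apply_eq_or_eq_neg {Ψ Δ : Set V}
    (hΔ : IsOrthogonalSubset Ψ Δ) {β : V} (hβ : β ∈ Δ) {w : V ≃ₗᵢ[ℝ] V} (hw : w ∈ weylGroup Δ) :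
    w β = β ∨ w β = -β := by
  have refl : ∀ α ∈ Δ, rootReflection α β = β ∨ rootReflection α β = -β := by
    intro α hα
    by_cases h : β = α
    · subst h; exact Or.inr (rootReflection_self β)
    · exact Or.inl (rootReflection_of_inner_eq_zero (hΔ.2 β hβ α hα h))
  induction hw using Subgroup.closure_induction'' with
  | mem x hx => obtain ⟨α, hα, rfl⟩ := hx; exact refl α hα
  | inv_mem x hx => obtain ⟨α, hα, rfl⟩ := hx; rw [rootReflection_inv]; exact refl α hα
  | one => exact Or.inl rfl
  | mul x y _ _ hx hy =>
    change x (y β) = β ∨ x (y β) = -β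
    rcases hx with hx | hx <;> rcases hy with hy | hy <;> simp [hx, hy]

/-- The root subsystem of the reflection subgroup generated by pairwise orthogonal roots consists
of these roots and their negatives. -/
theorem rootSubsystem_weylGroup_of_isOrthogonalSubset {Φ Δ : Set V} (hΦ : IsRootSystem Φ)
    (hΔ : IsOrthogonalSubset Φ Δ) : rootSubsystem Φ (weylGroup Δ) = Δ ∪ -Δ := by
  ext α
  constructor
  · rintro ⟨hα, hs⟩
    have hα0 : α ≠ 0 := fun h => hΦ.zero_notMem (h ▸ hα)
    -- Otherwise `weylGroup Δ` would fix `α`, while `s_α` negates it.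
    obtain ⟨β, hβ, hne⟩ : ∃ β ∈ Δ, ⟪α, β⟫ ≠ 0 := by
      by_contra! hc
      have h := weylGroup_apply_eq_self hc hs
      rw [rootReflection_self] at h
      refine hα0 ((smul_eq_zero.1 (?_ : (2 : ℝ) • α = 0)).resolve_left two_ne_zero)
      rw [two_smul, ← sub_eq_zero.2 h.symm, sub_neg_eq_add]
    have hp : pairing β α ≠ 0 := by
      rw [pairing, real_inner_comm]
      exact div_ne_zero (mul_ne_zero two_ne_zero hne) (inner_self_ne_zero.2 hα0)
    -- `s_α` does not fix `β`, so it negates it; hence `β` is a multiple of `α`, and reducedness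
    -- gives `β = ±α`.
    have h := hΔ.weylGroup_apply_eq_or_eq_neg hβ hs
    rw [rootReflection_apply] at h
    rcases h with h | h
    · exact absurd (sub_eq_self.1 h) (smul_ne_zero hp hα0)
    · have hβα : β = (pairing β α / 2) • α := by
        have h2 : pairing β α • α = (2 : ℝ) • β := by
          rw [two_smul, ← sub_eq_zero, ← neg_eq_zero, ← sub_eq_zero.2 h]; abel
        rw [div_eq_inv_mul, mul_smul, h2, smul_smul]
        norm_num
      rcases hΦ.reduced α hα _ (hβα ▸ hΔ.1 hβ) with hc | hc
      · rw [hc, one_smul] at hβα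
        exact Or.inl (hβα ▸ hβ)
      · rw [hc, neg_one_smul] at hβα
        exact Or.inr (Set.mem_neg.2 (hβα ▸ hβ))
  · rintro (h | h)
    · exact ⟨hΔ.1 h, rootReflection_mem_weylGroup h⟩
    · have h1 := hΦ.reflection_mem _ (hΔ.1 h) _ (hΔ.1 h)
      rw [rootReflection_self, neg_neg] at h1
      refine ⟨h1, ?_⟩
      have h2 : rootReflection α = rootReflection (-α) := by
        ext v
        simp [rootReflection_apply, pairing, neg_div]
      rw [h2]
      exact rootReflection_mem_weylGroup h

/-- A set of pairwise orthogonal roots is a simple subsystem. -/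
theorem IsOrthogonalSubset.isSimpleSubsystem {Φ Δ : Set V} (hΦ : IsRootSystem Φ)
    (hΔ : IsOrthogonalSubset Φ Δ) : IsSimpleSubsystem Φ Δ := by
  refine ⟨weylGroup Δ, ⟨_, Set.image_mono hΔ.1, rfl⟩, ?_⟩
  rw [rootSubsystem_weylGroup_of_isOrthogonalSubset hΦ hΔ]
  have hne : ∀ β ∈ Δ, β ≠ 0 := fun β hβ h => hΦ.zero_notMem (h ▸ hΔ.1 hβ)
  -- By orthogonality the cone over `Δ` pairs nonnegatively with each `β ∈ Δ`, so it never contains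
  -- `-β`.
  have hcone : ∀ β ∈ Δ, ∀ v ∈ Submodule.span ℝ≥0 Δ, 0 ≤ ⟪v, β⟫ := by
    intro β hβ v hv
    induction hv using Submodule.span_induction with
    | mem x hx =>
      by_cases h : x = β
      · rw [h]; exact real_inner_self_nonneg
      · exact (hΔ.2 x hx β hβ h).ge
    | zero => simp
    | add x y _ _ hx hy => rw [inner_add_left]; positivity
    | smul a x _ hx => rw [NNReal.smul_def, real_inner_smul_left]; exact mul_nonneg a.2 hx
  have hpos : positivePart (Δ ∪ -Δ) Δ = Δ := by
    apply Set.Subset.antisymm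
    · rintro α ⟨h | h, hs⟩
      · exact h
      · have h1 := hcone _ h α hs
        rw [inner_neg_right] at h1
        have h2 := real_inner_self_pos.2 (neg_ne_zero.1 (hne _ h))
        linarith
    · exact fun α hα => ⟨Or.inl hα, Submodule.subset_span hα⟩
  refine ⟨Set.subset_union_left, ?_, by rw [hpos], ?_⟩
  · exact linearIndependent_of_ne_zero_of_inner_eq_zero (𝕜 := ℝ) (fun i : Δ => hne i i.2)
      fun i j hij => hΔ.2 i i.2 j j.2 fun h => hij (Subtype.ext h)
  · rw [hpos, Set.disjoint_left]
    intro α h1 h2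
    have h3 := hcone _ h2 α (Submodule.subset_span h1)
    rw [inner_neg_right] at h3
    have h4 := real_inner_self_pos.2 (hne _ h1)
    linarith

theorem IsOfTypeA1Pow.inner_eq_zero {Δ : Set V} {n : ℕ} (h : IsOfTypeA1Pow Δ n) {α β : V}
    (hα : α ∈ Δ) (hβ : β ∈ Δ) (hne : α ≠ β) : ⟪α, β⟫ = 0 := by
  obtain ⟨b, hb⟩ := h
  have h1 := hb (b.symm ⟨β, hβ⟩) (b.symm ⟨α, hα⟩)
  have hij : (b.symm ⟨β, hβ⟩).2 ≠ (b.symm ⟨α, hα⟩).2 := fun h => hne (by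
    have := b.symm.injective (Prod.ext (Subsingleton.elim _ _) h)
    exact (congrArg Subtype.val this).symm)
  rw [Matrix.blockDiagonal_apply, if_neg hij] at h1
  simp only [Equiv.apply_symm_apply, pairing, Int.cast_zero, div_eq_zero_iff, mul_eq_zero,
    OfNat.ofNat_ne_zero, false_or, inner_self_eq_zero] at h1
  rcases h1 with h1 | h1
  -- The other case, `β = 0`, is the one where the pairing vanishes through division by zero.
  · exact h1
  · rw [h1, inner_zero_right]

theorem isOfTypeA1Pow_ncard {Δ : Set V} (hfin : Δ.Finite) (hne : ∀ α ∈ Δ, α ≠ 0)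
    (h : ∀ α ∈ Δ, ∀ β ∈ Δ, α ≠ β → ⟪α, β⟫ = 0) : IsOfTypeA1Pow Δ Δ.ncard := by
  have := hfin.to_subtype
  let b : Fin Δ.ncard ≃ Δ := (Finite.equivFinOfCardEq (Nat.card_coe_set_eq Δ)).symm
  refine ⟨(Equiv.uniqueProd _ _).trans b, fun i j => ?_⟩
  rw [Matrix.blockDiagonal_apply]
  by_cases hij : i.2 = j.2
  · have hij' : i = j := Prod.ext (Subsingleton.elim _ _) hij
    subst hij'
    have h0 : ⟪(b i.2 : V), (b i.2 : V)⟫ ≠ 0 := inner_self_ne_zero.2 (hne _ (b i.2).2)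
    change 2 * ⟪(b i.2 : V), (b i.2 : V)⟫ / ⟪(b i.2 : V), (b i.2 : V)⟫ = _
    rw [mul_div_cancel_right₀ _ h0]
    simp [CartanMatrix.A]
  · have h0 : ⟪(b j.2 : V), (b i.2 : V)⟫ = 0 := h _ (b j.2).2 _ (b i.2).2 fun h =>
      hij (b.injective (Subtype.ext h)).symm
    simp [pairing, h0, hij]

/-- The simple subsystems of type `A₁ⁿ` with roots of length `L` are the sets of pairwise
orthogonal roots of length `L`. -/
theorem isA1SubsystemOfLength_iff {Φ : Set V} (hΦ : IsRootSystem Φ) (L : ℝ) (Δ : Set V) :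
    IsA1SubsystemOfLength Φ L Δ ↔ IsOrthogonalSubset {α ∈ Φ | ‖α‖ = L} Δ := by
  constructor
  · rintro ⟨⟨W', -, hs⟩, ⟨n, hn⟩, hlen⟩
    exact ⟨fun α hα => ⟨(hs.subset hα).1, hlen α hα⟩,
      fun α hα β hβ hne => hn.inner_eq_zero hα hβ hne⟩
  · rintro ⟨hsub, horth⟩
    have hsub' : Δ ⊆ Φ := fun α hα => (hsub hα).1
    exact ⟨IsOrthogonalSubset.isSimpleSubsystem hΦ ⟨hsub', horth⟩,
      ⟨_, isOfTypeA1Pow_ncard (hΦ.finite.subset hsub')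
        (fun α hα h => hΦ.zero_notMem (h ▸ hsub' hα)) horth⟩, fun α hα => (hsub hα).2⟩

theorem IsRootSystem.isEqualLengthSystem {Φ : Set V} (hΦ : IsRootSystem Φ)
    (hcrys : IsCrystallographic Φ) (L : ℝ) : IsEqualLengthSystem L {α ∈ Φ | ‖α‖ = L} where
  finite := hΦ.finite.subset fun _ h => h.1
  norm_eq _ h := h.2
  reflection_mem α hα β hβ :=
    ⟨hΦ.reflection_mem α hα.1 β hβ.1, (LinearIsometryEquiv.norm_map _ _).trans hβ.2⟩
  crystallographic α hα β hβ := hcrys α hα.1 β hβ.1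

end

end EuclideanRoots

theorem proposition5p3 {V : Type*} [NormedAddCommGroup V] [InnerProductSpace ℝ V]
    [FiniteDimensional ℝ V] (Φ : Set V) (hΦ : EuclideanRoots.IsRootSystem Φ)
    (hcrys : EuclideanRoots.IsCrystallographic Φ) (L : ℝ) (hL : 0 < L) (Δ Δ' : Set V)
    (hΔ : Maximal (EuclideanRoots.IsA1SubsystemOfLength Φ L) Δ)
    (hΔ' : Maximal (EuclideanRoots.IsA1SubsystemOfLength Φ L) Δ') :
    ∃ w ∈ EuclideanRoots.weylGroup Φ, w '' Δ = Δ' := by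
  have heq : EuclideanRoots.IsA1SubsystemOfLength Φ L =
      EuclideanRoots.IsOrthogonalSubset {α ∈ Φ | ‖α‖ = L} :=
    funext fun Γ => propext (EuclideanRoots.isA1SubsystemOfLength_iff hΦ L Γ)
  rw [heq] at hΔ hΔ'
  obtain ⟨w, hw, h⟩ := (hΦ.isEqualLengthSystem hcrys L).exists_image_eq hL hΔ hΔ'
  exact ⟨w, EuclideanRoots.weylGroup_mono (fun _ h => h.1) hw, h⟩
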